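/- All groups are finite. For a group $G$ with identity $e$, the power graph $\mathcal P_G$ is the simple graph with vertex set $G$ in which two distinct elements are adjacent if one of them is a power of the other; $d$ denotes its graph distance. A resolving set is a set $S\subseteq G$ such that any $u,v\in G$ with $d(u,s)=d(v,s)$ for all $s\in S$ are equal, and the metric dimension $\dim(\mathcal P_G)$ is the minimum cardinality of a resolving set. For $x\in G$ let $N(x)$ be the set of neighbours of $x$ in $\mathcal P_G$ and $N[x]=N(x)\cup\{x\}$. Write $x\equiv y$ if $N(x)=N(y)$ or $N[x]=N[y]$; this is an equivalence relation. Let $\overline{x}$ be the class of $x$ and $\mathcal U(G)=\{\overline{x} : x\in G\}$. For $x,y\in G$ put $R\{x,y\}=\{z\in G : d(x,z)\neq d(y,z)\}$. A resolving involution of $G$ is an element $w$ of order $2$ for which there are $x,y\in G\setminus\overline{w}$ with $R\{x,y\}=\{x,y,w\}$; let $W(G)$ be the set of resolving involutions of $G$. Let $\Psi$ be the class of noncyclic groups $G$ for which there is an odd prime $p$ such that (C1) the prime divisors of $|G|$ are exactly $2$ and $p$; (C2) $G$ has a unique subgroup of order $p$; (C3) $G$ has no element of order $4$; (C4) each involution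 of $G$ is contained in a cyclic subgroup of order $2p$. Theorem. Let $G$ be a finite group. (i) If $G\in\Psi$, then $\dim(\mathcal P_G)=|G|-|\mathcal U(G)|+1$. (ii) If $G\notin\Psi$, then $\dim(\mathcal P_G)=|G|-|\mathcal U(G)|+|W(G)|$. -/

import Mathlib

namespace PowerGraph

/-- A set `S` of vertices of `Γ` is resolving if the distances to the members of `S`
determine every vertex. -/
def IsResolvingSet {V : Type*} (Γ : SimpleGraph V) (S : Set V) : Prop :=
  ∀ u v : V, (∀ s ∈ S, Γ.dist u s = Γ.dist v s) → u = v

/-- The metric dimension: the minimum cardinality of a resolving set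
(used for finite connected graphs). -/
noncomputable def metricDim {V : Type*} (Γ : SimpleGraph V) : ℕ :=
  sInf {n : ℕ | ∃ S : Set V, IsResolvingSet Γ S ∧ S.ncard = n}

/-- The power graph of `G`: two distinct elements are adjacent if one is a power of the other. -/
def powerGraph (G : Type*) [Group G] : SimpleGraph G where
  Adj x y := x ≠ y ∧ ((∃ m : ℕ, y = x ^ m) ∨ (∃ m : ℕ, x = y ^ m))
  symm := ⟨fun _ _ h => ⟨h.1.symm, h.2.symm⟩⟩
  loopless := ⟨fun _ h => h.1 rfl⟩

/-- The power graph is connected, since the identity is adjacent to every other vertex;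
so `SimpleGraph.dist` is the genuine distance on it. -/
theorem powerGraph_connected (G : Type*) [Group G] : (powerGraph G).Connected := by
  have h : ∀ x : G, (powerGraph G).Reachable x 1 := by
    intro x
    by_cases hx : x = 1
    · subst hx
      exact SimpleGraph.Reachable.refl _
    · have hadj : (powerGraph G).Adj x 1 := ⟨hx, Or.inl ⟨0, (pow_zero x).symm⟩⟩
      exact hadj.reachable
  exact ⟨fun x y => (h x).trans (h y).symm⟩

/-- The closed neighbourhood `N[x]` of `x` in the power graph. -/
def closedNbhd {G : Type*} [Group G] (x : G) : Set G :=
  insert x ((powerGraph G).neighborSet x)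

/-- The twin relation: `N(x) = N(y)` or `N[x] = N[y]`. -/
def Twin {G : Type*} [Group G] (x y : G) : Prop :=
  (powerGraph G).neighborSet x = (powerGraph G).neighborSet y ∨ closedNbhd x = closedNbhd y

/-- The class of `x` under the twin relation. -/
def twinClass {G : Type*} [Group G] (x : G) : Set G :=
  {y : G | Twin x y}

/-- The set `U(G)` of all twin classes. -/
def twinClasses (G : Type*) [Group G] : Set (Set G) :=
  {C : Set G | ∃ x : G, C = twinClass x}

/-- The set `R{x, y}` of the elements that have different distances to `x` and `y`. -/
def resolvers {G : Type*} [Group G] (x y : G) : Set G :=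
  {z : G | (powerGraph G).dist x z ≠ (powerGraph G).dist y z}

/-- The set `W(G)` of all resolving involutions: the involutions `w` such that
`R{x, y} = {x, y, w}` for some `x, y` outside the twin class of `w`. -/
def resolvingInvolutions (G : Type*) [Group G] : Set G :=
  {w : G | orderOf w = 2 ∧
    ∃ x y : G, x ∉ twinClass w ∧ y ∉ twinClass w ∧ resolvers x y = {x, y, w}}

/-- The class `Ψ` of noncyclic groups satisfying (C1)-(C4) for some odd prime `p`. -/
def IsPsi (G : Type*) [Group G] : Prop :=
  ¬ IsCyclic G ∧ ∃ p : ℕ, p.Prime ∧ Odd p ∧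
    (Nat.card G).primeFactors = {2, p} ∧
    (∃! H : Subgroup G, Nat.card H = p) ∧
    (¬ ∃ x : G, orderOf x = 4) ∧
    (∀ w : G, orderOf w = 2 → ∃ C : Subgroup G, IsCyclic C ∧ Nat.card C = 2 * p ∧ w ∈ C)

end PowerGraph

/-! The identity is adjacent to every other element, so distances are 0, 1 or 2 and a set `S`
resolves exactly when any two elements outside `S` are told apart by `Comparable` with some member
of `S` (`isResolvingSet_iff`). Twins cannot both lie outside `S`, so `Sᶜ` embeds in the set of twin
classes; the theorem counts how many classes must lie entirely in `S`.

Upper bound: start from the complement of a transversal `T`. If it fails on `x, y ∈ T`, all their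
separators lie in `T`, so those other than `x, y` are alone in their classes; since `z` and `z⁻¹`
are twins, they are involutions. When `x, y ≠ 1`, only one such involution can exist
(`separating_involution_unique`), and it is resolving. When one of the two is `1`, two or more of
them force the group into `Ψ` (`isPsi_of_singleton`). So adding `W(G)` to the set suffices outside
`Ψ`. Inside `Ψ` it suffices to add the representative of the class of `1`, because pairs of
nontrivial elements with a single separating involution do not occur there (`IsPsi.not_isSplitBy`).

Lower bound: for a resolving involution `w` with pair `x, y`, the set `S` must contain the whole
class of `x`, of `y` or of `w` (`exists_missing`). Triples of distinct involutions share no class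
(`IsSplitBy.eq_of_twin`), unless the pair contains `1`, and then `w` is the only involution. In `Ψ`
the pair formed by `1` and an element of order `p` costs one class. -/

namespace PowerGraph

open Subgroup

variable {G : Type*} [Group G]

/-! ### Comparability and involutions in cyclic subgroups -/

/-- Two elements are comparable if one of them lies in the cyclic subgroup generated by the
other. -/
def Comparable (x y : G) : Prop := x ∈ zpowers y ∨ y ∈ zpowers x

theorem Comparable.symm {x y : G} (h : Comparable x y) : Comparable y x := Or.symm h

theorem comparable_comm {x y : G} : Comparable x y ↔ Comparable y x := ⟨.symm, .symm⟩

theorem comparable_refl (x : G) : Comparable x x := Or.inl (mem_zpowers x)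

theorem comparable_one_left (x : G) : Comparable 1 x := Or.inl (one_mem _)

theorem comparable_inv_left {x y : G} : Comparable x⁻¹ y ↔ Comparable x y := by
  unfold Comparable
  rw [zpowers_inv, inv_mem_iff]

theorem mem_zpowers_trans {x y z : G} (h : x ∈ zpowers y) (hyz : y ∈ zpowers z) :
    x ∈ zpowers z :=
  (zpowers_le.2 hyz) h

/-- An element of order two generates a subgroup with two elements. -/
theorem eq_one_or_eq_of_mem_zpowers {w x : G} (hw : orderOf w = 2) (h : x ∈ zpowers w) :
    x = 1 ∨ x = w := by
  obtain ⟨k, rfl⟩ := mem_zpowers_iff.1 h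
  have hw2 : w ^ (2 : ℤ) = 1 := by
    have := pow_orderOf_eq_one w
    rw [hw] at this
    exact_mod_cast this
  obtain ⟨j, rfl⟩ | ⟨j, rfl⟩ := Int.even_or_odd k
  · left
    rw [← two_mul, zpow_mul, hw2, one_zpow]
  · right
    rw [zpow_add, zpow_mul, hw2, one_zpow, one_mul, zpow_one]

theorem mem_zpowers_of_comparable {w x : G} (hw : orderOf w = 2) (hx : x ≠ 1)
    (h : Comparable w x) : w ∈ zpowers x := by
  rcases h with h | h
  · exact h
  · rcases eq_one_or_eq_of_mem_zpowers hw h with rfl | rfl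
    · exact absurd rfl hx
    · exact mem_zpowers x

theorem ne_one_of_orderOf_eq_two {w : G} (hw : orderOf w = 2) : w ≠ 1 := by
  rintro rfl
  simp at hw

theorem inv_ne_self {x : G} (h1 : x ≠ 1) (h2 : orderOf x ≠ 2) : x⁻¹ ≠ x := by
  intro h
  apply h2
  refine orderOf_eq_prime ?_ h1
  rw [pow_two]
  nth_rewrite 1 [← h]
  exact inv_mul_cancel x

/-- An involution and an element of odd order are not comparable. -/
theorem not_comparable_of_odd {w y : G} (hw : orderOf w = 2) (hy1 : y ≠ 1)
    (hy : Odd (orderOf y)) : ¬ Comparable y w := by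
  intro h
  have := orderOf_dvd_of_mem_zpowers (mem_zpowers_of_comparable hw hy1 h.symm)
  rw [hw] at this
  exact (Nat.not_even_iff_odd.2 hy) (even_iff_two_dvd.2 this)

theorem left_mem_resolvers {x y : G} (h : x ≠ y) : x ∈ resolvers x y := by
  change _ ≠ _
  rw [SimpleGraph.dist_self]
  exact fun h0 => h (((powerGraph_connected G).dist_eq_zero_iff).1 h0.symm).symm

theorem resolvers_comm (x y : G) : resolvers x y = resolvers y x := by
  ext z
  exact ne_comm

theorem Twin.refl (x : G) : Twin x x := Or.inl rfl

theorem Twin.symm {x y : G} (h : Twin x y) : Twin y x := h.imp Eq.symm Eq.symm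

section Finite

variable [Finite G]

/-- A cyclic subgroup contains at most one involution. -/
theorem involution_unique {g u w : G} (hu : orderOf u = 2) (hw : orderOf w = 2)
    (hug : u ∈ zpowers g) (hwg : w ∈ zpowers g) : u = w := by
  have h : zpowers u = zpowers w :=
    Subgroup.eq_of_le_of_card_ge (zpowers_le.2 ?_) (by simp [hu, hw])
  · have := h ▸ mem_zpowers u
    exact (eq_one_or_eq_of_mem_zpowers hw this).resolve_left (ne_one_of_orderOf_eq_two hu)
  · obtain ⟨a, rfl⟩ := mem_zpowers_iff.1 hug
    obtain ⟨b, rfl⟩ := mem_zpowers_iff.1 hwg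
    -- If `g` has order `2m` and `g ^ c` has order 2, then `c` is an odd multiple of `m`, so `g ^ c
    -- = g ^ m`.
    have key : ∀ c : ℤ, orderOf (g ^ c) = 2 → g ^ c = g ^ (orderOf g / 2) := by
      intro c hc
      have hc2 : g ^ (c * 2) = 1 := by
        have := pow_orderOf_eq_one (g ^ c)
        rw [hc, ← zpow_natCast, ← zpow_mul] at this
        exact_mod_cast this
      have hdvd : (orderOf g : ℤ) ∣ c * 2 := orderOf_dvd_iff_zpow_eq_one.2 hc2
      have h2 : 2 ∣ orderOf g := by
        rw [← hc]
        exact orderOf_dvd_of_mem_zpowers (mem_zpowers_iff.2 ⟨c, rfl⟩)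
      have hc1 : ¬ (orderOf g : ℤ) ∣ c := by
        intro hd
        exact ne_one_of_orderOf_eq_two hc (orderOf_dvd_iff_zpow_eq_one.1 hd)
      obtain ⟨m, hm⟩ := h2
      rw [hm] at hdvd hc1 ⊢
      obtain ⟨k, hk⟩ := hdvd
      have hck : c = m * k := by push_cast at hk; linarith
      rw [Nat.mul_div_cancel_left _ two_pos, ← zpow_natCast]
      obtain ⟨j, rfl⟩ | ⟨j, rfl⟩ := Int.even_or_odd k
      · exact absurd ⟨j, by rw [hck]; push_cast; ring⟩ hc1
      · have : c = m + (orderOf g : ℤ) * j := by rw [hck, hm]; push_cast; ring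
        rw [this, zpow_add, zpow_mul, zpow_natCast g (orderOf g), pow_orderOf_eq_one, one_zpow,
          mul_one]
    rw [key a hu, ← key b hw]
    exact mem_zpowers _

theorem exists_involution {x : G} (h : 2 ∣ orderOf x) : ∃ w ∈ zpowers x, orderOf w = 2 := by
  obtain ⟨w, hw⟩ := exists_prime_orderOf_dvd_card' (G := zpowers x) 2 (by simpa using h)
  exact ⟨w, w.2, by simpa using hw⟩

/-! ### Distances, resolving sets and twins through comparability -/

theorem powerGraph_adj_iff {x y : G} : (powerGraph G).Adj x y ↔ x ≠ y ∧ Comparable x y := by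
  have key : ∀ a b : G, (∃ m : ℕ, b = a ^ m) ↔ b ∈ zpowers a := by
    intro a b
    rw [← mem_powers_iff_mem_zpowers, Submonoid.mem_powers_iff]
    exact exists_congr fun _ => eq_comm
  change _ ∧ _ ↔ _
  rw [key, key, or_comm]
  rfl

theorem mem_closedNbhd_iff {x y : G} : y ∈ closedNbhd x ↔ Comparable x y := by
  rw [closedNbhd, Set.mem_insert_iff, SimpleGraph.mem_neighborSet, powerGraph_adj_iff]
  constructor
  · rintro (rfl | h)
    · exact comparable_refl _
    · exact h.2
  · intro h
    by_cases hxy : y = x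
    · exact Or.inl hxy
    · exact Or.inr ⟨Ne.symm hxy, h⟩

theorem powerGraph_dist_of_comparable {x y : G} (hne : x ≠ y) (h : Comparable x y) :
    (powerGraph G).dist x y = 1 :=
  SimpleGraph.dist_eq_one_iff_adj.2 (powerGraph_adj_iff.2 ⟨hne, h⟩)

theorem powerGraph_dist_of_not_comparable {x y : G} (h : ¬ Comparable x y) :
    (powerGraph G).dist x y = 2 := by
  have hx : x ≠ 1 := by rintro rfl; exact h (comparable_one_left y)
  have hy : y ≠ 1 := by rintro rfl; exact h (comparable_one_left x).symm
  have hne : x ≠ y := by rintro rfl; exact h (comparable_refl x)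
  have h1 := powerGraph_dist_of_comparable hx (comparable_one_left x).symm
  have h2 := powerGraph_dist_of_comparable hy.symm (comparable_one_left y)
  have h3 := (powerGraph_connected G).dist_triangle (u := x) (v := 1) (w := y)
  have h4 : (powerGraph G).dist x y ≠ 0 := fun h0 =>
    hne (((powerGraph_connected G).dist_eq_zero_iff).1 h0)
  have h5 : (powerGraph G).dist x y ≠ 1 := fun h0 =>
    h (powerGraph_adj_iff.1 (SimpleGraph.dist_eq_one_iff_adj.1 h0)).2
  omega

theorem powerGraph_dist_eq_iff {x y z : G} (hx : z ≠ x) (hy : z ≠ y) :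
    (powerGraph G).dist x z = (powerGraph G).dist y z ↔ (Comparable x z ↔ Comparable y z) := by
  by_cases h : Comparable x z <;> by_cases h' : Comparable y z <;>
    simp [h, h', powerGraph_dist_of_comparable, powerGraph_dist_of_not_comparable, hx.symm,
      hy.symm]

theorem mem_resolvers_iff {x y z : G} (hx : z ≠ x) (hy : z ≠ y) :
    z ∈ resolvers x y ↔ ¬ (Comparable x z ↔ Comparable y z) :=
  (powerGraph_dist_eq_iff hx hy).not

/-- A member of `S` is recognised by its distance 0 to itself, so only pairs outside `S` matter, and
their distances to `S` are 1 or 2. -/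
theorem isResolvingSet_iff {S : Set G} : IsResolvingSet (powerGraph G) S ↔
    ∀ x ∉ S, ∀ y ∉ S, x ≠ y → ∃ s ∈ S, ¬ (Comparable x s ↔ Comparable y s) := by
  constructor
  · intro h x hx y hy hne
    by_contra! hc
    refine hne (h x y fun s hs => (powerGraph_dist_eq_iff ?_ ?_).2 (hc s hs))
    · rintro rfl; exact hx hs
    · rintro rfl; exact hy hs
  · intro h x y hxy
    by_contra hne
    have hx : x ∉ S := fun hx => left_mem_resolvers hne (hxy x hx)
    have hy : y ∉ S := fun hy => left_mem_resolvers (Ne.symm hne) (hxy y hy).symm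
    obtain ⟨s, hs, hs'⟩ := h x hx y hy hne
    refine hs' ((powerGraph_dist_eq_iff ?_ ?_).1 (hxy s hs))
    · rintro rfl; exact hx hs
    · rintro rfl; exact hy hs

/-- This merges the two kinds of twins: whether `x` and `y` are comparable decides if the closed or
the open neighbourhoods agree. -/
theorem twin_iff {x y : G} :
    Twin x y ↔ ∀ z, z ≠ x → z ≠ y → (Comparable x z ↔ Comparable y z) := by
  constructor
  · rintro (h | h) z hx hy
    · have := Set.ext_iff.1 h z
      simp only [SimpleGraph.mem_neighborSet, powerGraph_adj_iff] at this
      simpa [hx.symm, hy.symm] using this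
    · have := Set.ext_iff.1 h z
      simpa only [mem_closedNbhd_iff] using this
  · intro h
    by_cases hxy : Comparable x y
    · right
      ext z
      rw [mem_closedNbhd_iff, mem_closedNbhd_iff]
      by_cases hx : z = x
      · subst hx
        exact iff_of_true (comparable_refl _) hxy.symm
      by_cases hy : z = y
      · subst hy
        exact iff_of_true hxy (comparable_refl _)
      exact h z hx hy
    · left
      ext z
      rw [SimpleGraph.mem_neighborSet, SimpleGraph.mem_neighborSet, powerGraph_adj_iff,
        powerGraph_adj_iff]
      by_cases hx : z = x
      · subst hx
        exact iff_of_false (fun h => h.1 rfl) (fun h => hxy h.2.symm)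
      by_cases hy : z = y
      · subst hy
        exact iff_of_false (fun h => hxy h.2) (fun h => h.1 rfl)
      rw [h z hx hy]
      exact and_congr_left fun _ => iff_of_true (Ne.symm hx) (Ne.symm hy)

theorem Twin.comparable_iff {x y z : G} (h : Twin x y) (hx : z ≠ x) (hy : z ≠ y) :
    Comparable x z ↔ Comparable y z :=
  twin_iff.1 h z hx hy

theorem Twin.trans {x y z : G} (h : Twin x y) (h' : Twin y z) : Twin x z := by
  by_cases hxy : x = y
  · exact hxy ▸ h'
  by_cases hyz : y = z
  · exact hyz ▸ h
  refine twin_iff.2 fun u hux huz => ?_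
  -- Chaining the two equivalences misses only the middle vertex. There `x` first tests `y` against
  -- `z`, and then `z` tests `x` against `y`.
  by_cases huy : u = y
  · subst huy
    by_cases hxz : x = z
    · rw [hxz]
    rw [comparable_comm (x := x), h'.comparable_iff hxy hxz, comparable_comm (x := z),
      h.comparable_iff (Ne.symm hxz) (Ne.symm hyz), comparable_comm]
  · exact (h.comparable_iff hux huy).trans (h'.comparable_iff huy huz)

theorem twinClass_eq_iff {x y : G} : twinClass x = twinClass y ↔ Twin x y := by
  constructor
  · intro h
    have : y ∈ twinClass x := h ▸ Twin.refl y
    exact this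
  · intro h
    ext z
    exact ⟨fun hz => h.symm.trans hz, fun hz => h.trans hz⟩

/-- Twins are comparable, unless both have order two. -/
theorem Twin.comparable {x y : G} (h : Twin x y) (hx : orderOf x ≠ 2) : Comparable x y := by
  by_cases hx1 : x = 1
  · subst hx1
    exact comparable_one_left y
  by_cases hy : x⁻¹ = y
  · subst hy
    exact (comparable_inv_left.2 (comparable_refl x)).symm
  · have h1 := (h.comparable_iff (inv_ne_self hx1 hx) hy).1
      (comparable_inv_left.2 (comparable_refl x)).symm
    exact comparable_inv_left.1 h1.symm

theorem twin_inv (x : G) : Twin x x⁻¹ :=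
  twin_iff.2 fun _ _ _ => comparable_inv_left.symm

end Finite

/-! ### Pairs separated only by involutions -/

/-- The involution `w` is the only element besides `x` and `y` that separates `x` from `y`, where
`y` is a power of `x` and `w` is a power of `x` but not of `y`. -/
structure IsSplitBy (x y w : G) : Prop where
  orderOf_eq : orderOf w = 2
  ne_one : y ≠ 1
  ne : x ≠ w
  mem_left : w ∈ zpowers x
  not_mem_right : w ∉ zpowers y
  mem : y ∈ zpowers x
  comparable_iff : ∀ z, z ≠ x → z ≠ y → z ≠ w → (Comparable x z ↔ Comparable y z)

theorem IsSplitBy.orderOf_left_ne_two {x y w : G} (h : IsSplitBy x y w) : orderOf x ≠ 2 := by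
  intro hx
  rcases eq_one_or_eq_of_mem_zpowers hx h.mem_left with h0 | h0
  · exact ne_one_of_orderOf_eq_two h.orderOf_eq h0
  · exact h.ne h0.symm

section Structure

variable [Finite G]

/-- An involution that has no twin besides itself. -/
def IsSingletonInvolution (w : G) : Prop := orderOf w = 2 ∧ ∀ z, Twin w z → z = w

/-- If `w` is an involution not comparable with `y`, and every element that is not comparable
with `y` is an involution without proper twins, then `y` lies in the cyclic subgroup generated by
`w * y`. -/
theorem mem_zpowers_mul {y w : G} (h : ∀ z, ¬ Comparable y z → IsSingletonInvolution z)
    (hw : ¬ Comparable y w) : y ∈ zpowers (w * y) := by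
  by_cases hc : Comparable y (w * y)
  · rcases hc with hc | hc
    · exact hc
    · exact absurd (Or.inr ((mul_mem_cancel_right (mem_zpowers y)).1 hc)) hw
  exfalso
  have hy1 : y ≠ 1 := by rintro rfl; exact hw (comparable_one_left w)
  have hne : w * y ≠ w := by simpa using hy1
  obtain ⟨hw2, hws⟩ := h w hw
  obtain ⟨hv2, -⟩ := h _ hc
  have hnt : ¬ Twin w (w * y) := fun ht => hne (hws _ ht)
  -- Some `g` is comparable with exactly one of `w` and `w * y`; call that one `v`. Then `g` is no
  -- involution, hence comparable with `y`. If `y` is a power of `g`, it commutes with `v`, becomes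
  -- an involution and equals `v`; otherwise `v` is a power of `y`.
  have key : ∃ v g, ¬ Comparable y v ∧ (Commute v y → Commute w y) ∧ g ≠ 1 ∧ g ≠ v ∧
      Comparable v g := by
    rw [twin_iff] at hnt
    push Not at hnt
    obtain ⟨g, hg1, hg2, hg⟩ := hnt
    have hg0 : g ≠ 1 := by
      rintro rfl
      rcases hg with hg | hg
      · exact hg.2 (comparable_one_left _).symm
      · exact hg.1 (comparable_one_left _).symm
    rcases hg with hg | hg
    · exact ⟨w, g, hw, id, hg0, hg1, hg.1⟩
    · refine ⟨w * y, g, hc, fun hcomm => ?_, hg0, hg2, hg.2⟩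
      have h1 : w * y * y = y * (w * y) := hcomm
      rw [← mul_assoc y w y] at h1
      exact mul_right_cancel h1
  obtain ⟨v, g, hyv, hcomm, hg1, hgv, hvg⟩ := key
  have hv := (h v hyv).1
  have hvg := mem_zpowers_of_comparable hv hg1 hvg
  have hg2 : orderOf g ≠ 2 := fun hg2 => by
    rcases eq_one_or_eq_of_mem_zpowers hg2 hvg with h | h
    · exact ne_one_of_orderOf_eq_two hv h
    · exact hgv h.symm
  have hyg : Comparable y g := by
    by_contra hyg
    exact hg2 (h g hyg).1
  rcases hyg with hyg | hyg
  · have hvy : Commute v y := by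
      obtain ⟨a, rfl⟩ := mem_zpowers_iff.1 hvg
      obtain ⟨b, rfl⟩ := mem_zpowers_iff.1 hyg
      exact Commute.zpow_zpow_self g a b
    have hwy := hcomm hvy
    have hy2 : orderOf y = 2 := by
      refine orderOf_eq_prime ?_ hy1
      have h1 := pow_orderOf_eq_one (w * y)
      have h2 := pow_orderOf_eq_one w
      rw [hv2, hwy.mul_pow] at h1
      rw [hw2] at h2
      rwa [h2, one_mul] at h1
    apply hyv
    rw [involution_unique hv hy2 hvg hyg]
    exact comparable_refl y
  · exact hyv (Or.inr (mem_zpowers_trans hvg hyg))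

theorem commute_of_singleton {y w : G} (h : ∀ z, ¬ Comparable y z → IsSingletonInvolution z)
    (hw : ¬ Comparable y w) : Commute w y := by
  have hy := mem_zpowers_mul h hw
  obtain ⟨a, ha⟩ := mem_zpowers_iff.1 hy
  have h1 : Commute (w * y) y := by
    nth_rewrite 2 [← ha]
    exact (Commute.refl _).zpow_right a
  have h1 : w * y * y = y * (w * y) := h1
  rw [← mul_assoc y w y] at h1
  exact mul_right_cancel h1

/-- An involution in `zpowers y` would be `w`, the only one in `zpowers (w * y)`, so the order is
odd. For `v` of prime order `p` in `zpowers y`, the element `w * v` has order `2p`, so it must be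
comparable with `y`; this forces `y ∈ zpowers (w * v)`, and the odd order of `y` divides `p`. -/
theorem prime_orderOf_of_singleton {y w : G}
    (h : ∀ z, ¬ Comparable y z → IsSingletonInvolution z) (hw : ¬ Comparable y w) :
    (orderOf y).Prime ∧ Odd (orderOf y) := by
  have hy := mem_zpowers_mul h hw
  have hw2 := (h w hw).1
  have hwy := commute_of_singleton h hw
  have hwm : w ∈ zpowers (w * y) := (mul_mem_cancel_right hy).1 (mem_zpowers _)
  have hy1 : y ≠ 1 := by rintro rfl; exact hw (comparable_one_left w)
  have hodd : Odd (orderOf y) := by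
    rw [← Nat.not_even_iff_odd, even_iff_two_dvd]
    intro h2
    obtain ⟨u, hu, hu2⟩ := exists_involution h2
    have := involution_unique hu2 hw2 (mem_zpowers_trans hu hy) hwm
    exact hw (Or.inr (this ▸ hu))
  refine ⟨?_, hodd⟩
  obtain ⟨p, hp, hpd⟩ := Nat.exists_prime_and_dvd (mt orderOf_eq_one_iff.1 hy1)
  obtain ⟨v, hv⟩ := exists_prime_orderOf_dvd_card' (hp := ⟨hp⟩) (G := zpowers y) p
    (by simpa using hpd)
  obtain ⟨v, hvy⟩ := v
  replace hv : orderOf v = p := by simpa using hv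
  have hpodd : Odd p := hodd.of_dvd_nat hpd
  have hwv : Commute w v := by
    obtain ⟨a, rfl⟩ := mem_zpowers_iff.1 hvy
    exact hwy.zpow_right a
  have hcop : (orderOf w).Coprime (orderOf v) := by
    rw [hw2, hv]
    exact Nat.coprime_two_left.2 hpodd
  have hord := hwv.orderOf_mul_eq_mul_orderOf_of_coprime hcop
  rw [hw2, hv] at hord
  have hcmp : Comparable y (w * v) := by
    by_contra hc
    have := (h _ hc).1
    have := hp.two_le
    omega
  rcases hcmp with hc | hc
  · have hd := orderOf_dvd_of_mem_zpowers hc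
    rw [hord] at hd
    have hd' := (Nat.coprime_two_right.2 hodd).dvd_of_dvd_mul_left hd
    rw [Nat.dvd_antisymm hd' hpd]
    exact hp
  · exact absurd (Or.inr ((mul_mem_cancel_right hvy).1 hc)) hw

/-- If the elements not comparable with `y` are involutions without proper twins and there are
two of them, then the group belongs to the class `Ψ`. -/
theorem isPsi_of_singleton {y v w : G} (h : ∀ z, ¬ Comparable y z → IsSingletonInvolution z)
    (hv : ¬ Comparable y v) (hw : ¬ Comparable y w) (hvw : v ≠ w) : IsPsi G := by
  obtain ⟨hp, hodd⟩ := prime_orderOf_of_singleton h hw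
  have hy1 : y ≠ 1 := by rintro rfl; exact hw (comparable_one_left w)
  -- All of (C1)–(C3) follow from this: `zpowers y` lies inside every cyclic subgroup of order above
  -- 2.
  have hmem : ∀ z : G, z ≠ 1 → orderOf z ≠ 2 → y ∈ zpowers z := by
    intro z hz1 hz2
    have hc : Comparable y z := by
      by_contra hc
      exact hz2 (h z hc).1
    rcases hc with hc | hc
    · exact hc
    · have hd := orderOf_dvd_of_mem_zpowers hc
      have hz := (hp.eq_one_or_self_of_dvd _ hd).resolve_left (mt orderOf_eq_one_iff.1 hz1)
      have : zpowers z = zpowers y :=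
        Subgroup.eq_of_le_of_card_ge (zpowers_le.2 hc) (by simp [hz])
      rw [this]
      exact mem_zpowers y
  have hp2 : orderOf y ≠ 2 := by
    intro h2
    rw [h2] at hodd
    exact absurd hodd (by decide)
  refine ⟨?_, orderOf y, hp, hodd, ?_, ?_, ?_, ?_⟩
  · intro hcyc
    obtain ⟨g, hg⟩ := hcyc.exists_generator
    exact hvw (involution_unique (h v hv).1 (h w hw).1 (hg v) (hg w))
  · ext q
    rw [Nat.mem_primeFactors_of_ne_zero Nat.card_pos.ne', Finset.mem_insert,
      Finset.mem_singleton]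
    constructor
    · rintro ⟨hq, hqd⟩
      obtain ⟨z, hz⟩ := exists_prime_orderOf_dvd_card' (hp := ⟨hq⟩) q hqd
      by_cases hq2 : q = 2
      · exact Or.inl hq2
      · right
        have hz1 : z ≠ 1 := by
          rintro rfl
          rw [orderOf_one] at hz
          exact hq.one_lt.ne hz
        have := orderOf_dvd_of_mem_zpowers (hmem z hz1 (by rwa [hz]))
        rw [hz] at this
        exact ((Nat.prime_dvd_prime_iff_eq hp hq).1 this).symm
    · rintro (rfl | rfl)
      · exact ⟨Nat.prime_two, (h w hw).1 ▸ orderOf_dvd_natCard w⟩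
      · exact ⟨hp, orderOf_dvd_natCard y⟩
  · refine ⟨zpowers y, Nat.card_zpowers y, fun H hH => ?_⟩
    have : Nontrivial H := by
      rw [← Finite.one_lt_card_iff_nontrivial, hH]
      exact hp.one_lt
    obtain ⟨z, hz⟩ := exists_ne (1 : H)
    have hz1 : (z : G) ≠ 1 := fun h0 => hz (Subtype.ext h0)
    have hzd : orderOf (z : G) ∣ orderOf y := by
      rw [← hH, Subgroup.orderOf_coe]
      exact orderOf_dvd_natCard z
    have hzo := (hp.eq_one_or_self_of_dvd _ hzd).resolve_left (mt orderOf_eq_one_iff.1 hz1)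
    have hyH : y ∈ H := (zpowers_le.2 z.2) (hmem z hz1 (by rwa [hzo]))
    exact (Subgroup.eq_of_le_of_card_ge (zpowers_le.2 hyH) (by simp [hH])).symm
  · rintro ⟨z, hz⟩
    have hz1 : z ≠ 1 := by rintro rfl; simp at hz
    have := orderOf_dvd_of_mem_zpowers (hmem z hz1 (by rw [hz]; decide))
    rw [hz] at this
    exact hp2 ((Nat.prime_dvd_prime_iff_eq hp Nat.prime_two).1
      (hp.dvd_of_dvd_pow (show orderOf y ∣ 2 ^ 2 from this)))
  · intro u hu
    have huy := commute_of_singleton h (not_comparable_of_odd hu hy1 hodd)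
    refine ⟨zpowers (u * y), inferInstance, ?_, ?_⟩
    · rw [Nat.card_zpowers, huy.orderOf_mul_eq_mul_orderOf_of_coprime, hu]
      rw [hu]
      exact Nat.coprime_two_left.2 hodd
    · exact (mul_mem_cancel_right
        (mem_zpowers_mul h (not_comparable_of_odd hu hy1 hodd))).1 (mem_zpowers _)

namespace IsSplitBy

variable {x y w : G}

theorem odd_orderOf (h : IsSplitBy x y w) : Odd (orderOf y) := by
  rw [← Nat.not_even_iff_odd, even_iff_two_dvd]
  intro h2
  obtain ⟨u, hu, hu2⟩ := exists_involution h2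
  have := involution_unique hu2 h.orderOf_eq (mem_zpowers_trans hu h.mem) h.mem_left
  exact h.not_mem_right (this ▸ hu)

theorem comparable_of_mem (h : IsSplitBy x y w) {z : G} (hz : y ∈ zpowers z) : Comparable x z := by
  by_cases hzx : z = x
  · exact hzx ▸ comparable_refl x
  by_cases hzy : z = y
  · exact hzy ▸ Or.inr h.mem
  refine (h.comparable_iff z hzx hzy ?_).2 (Or.inl hz)
  rintro rfl
  exact not_comparable_of_odd h.orderOf_eq h.ne_one h.odd_orderOf (Or.inl hz)

/-- Thus `y` determines `w`, which is what keeps the triples of different resolving involutions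
apart. -/
theorem involution_eq (h : IsSplitBy x y w) {u z : G} (hu : orderOf u = 2)
    (huz : u ∈ zpowers z) (hz : y ∈ zpowers z) : u = w := by
  rcases h.comparable_of_mem hz with hc | hc
  · exact involution_unique hu h.orderOf_eq huz (mem_zpowers_trans h.mem_left hc)
  · exact involution_unique hu h.orderOf_eq (mem_zpowers_trans huz hc) h.mem_left

theorem orderOf_right_ne_two (h : IsSplitBy x y w) : orderOf y ≠ 2 := by
  intro hy
  have := h.odd_orderOf
  rw [hy] at this
  exact absurd this (by decide)

end IsSplitBy

/-- Only `y ∈ zpowers x` needs an argument: `x⁻¹` differs from `x`, `y` and `w`, so it does not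
separate `x` from `y`, which makes `x` and `y` comparable, while `x ∈ zpowers y` would put `w`
there. -/
theorem isSplitBy_of_mem {x y w : G} (hw : orderOf w = 2) (hx : x ≠ w) (hy1 : y ≠ 1)
    (hyw : y ≠ w) (hwx : w ∈ zpowers x) (hR : resolvers x y ⊆ {x, y, w})
    (hwR : w ∈ resolvers x y) : IsSplitBy x y w := by
  have hcx : Comparable x w := Or.inr hwx
  have hwy : w ∉ zpowers y := fun hwy =>
    (mem_resolvers_iff hx.symm hyw.symm).1 hwR (iff_of_true hcx (Or.inr hwy))
  have hiff : ∀ z, z ≠ x → z ≠ y → z ≠ w → (Comparable x z ↔ Comparable y z) := by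
    intro z h1 h2 h3
    by_contra hc
    rcases hR ((mem_resolvers_iff h1 h2).2 hc) with h | h | h
    exacts [h1 h, h2 h, h3 h]
  refine ⟨hw, hy1, hx, hwx, hwy, ?_, hiff⟩
  have hx1 : x ≠ 1 := by
    rintro rfl
    rw [zpowers_one_eq_bot, mem_bot] at hwx
    exact ne_one_of_orderOf_eq_two hw hwx
  have hx2 : orderOf x ≠ 2 := by
    intro hx2
    rcases eq_one_or_eq_of_mem_zpowers hx2 hwx with h0 | h0
    · exact ne_one_of_orderOf_eq_two hw h0
    · exact hx h0.symm
  have hxy : ¬ x ∈ zpowers y := fun h => hwy (mem_zpowers_trans hwx h)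
  have h1 : x⁻¹ ≠ y := by
    rintro rfl
    exact hxy (by simp)
  have h2 : x⁻¹ ≠ w := by
    rintro rfl
    exact hx2 (by simpa using hw)
  have h3 := (hiff x⁻¹ (inv_ne_self hx1 hx2) h1 h2).1
    (comparable_inv_left.2 (comparable_refl x)).symm
  exact (comparable_inv_left.1 h3.symm).resolve_left hxy

theorem isSplitBy_or_isSplitBy {x y w : G} (hw : orderOf w = 2) (hx1 : x ≠ 1) (hy1 : y ≠ 1)
    (hx : x ≠ w) (hy : y ≠ w) (hR : resolvers x y = {x, y, w}) :
    IsSplitBy x y w ∨ IsSplitBy y x w := by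
  have hwR : w ∈ resolvers x y := by rw [hR]; simp
  have hc := (mem_resolvers_iff hx.symm hy.symm).1 hwR
  by_cases hcx : Comparable x w
  · exact Or.inl (isSplitBy_of_mem hw hx hy1 hy (mem_zpowers_of_comparable hw hx1 hcx.symm)
      hR.subset hwR)
  · have hcy : Comparable y w := by
      by_contra hcy
      exact hc (iff_of_false hcx hcy)
    rw [resolvers_comm] at hR hwR
    refine Or.inr (isSplitBy_of_mem hw hy hx1 hx (mem_zpowers_of_comparable hw hy1 hcy.symm)
      ?_ hwR)
    rw [hR, Set.insert_comm]

/-- If only involutions separate `x` from `y`, and neither of these is trivial, then at most one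
does. -/
theorem separating_involution_unique {x y v w : G} (hx1 : x ≠ 1) (hy1 : y ≠ 1)
    (h : ∀ z, z ≠ x → z ≠ y → ¬ (Comparable x z ↔ Comparable y z) → orderOf z = 2)
    (hvx : v ≠ x) (hvy : v ≠ y) (hv : ¬ (Comparable x v ↔ Comparable y v))
    (hwx : w ≠ x) (hwy : w ≠ y) (hw : ¬ (Comparable x w ↔ Comparable y w)) : v = w := by
  have hv2 := h v hvx hvy hv
  have hw2 := h w hwx hwy hw
  -- Separators on the same side lie in one cyclic group and coincide. On opposite sides, distinct
  -- `v` and `w` make `x` and `y` incomparable; then `x⁻¹` separates them and would have to be an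
  -- involution.
  have key : ∀ {x y v w : G}, x ≠ 1 → y ≠ 1 →
      (∀ z, z ≠ x → z ≠ y → ¬ (Comparable x z ↔ Comparable y z) → orderOf z = 2) →
      v ≠ x → ¬ Comparable y v → orderOf v = 2 → orderOf w = 2 → v ∈ zpowers x →
      w ∈ zpowers y → v = w := by
    intro x y v w hx1 hy1 h hvx hyv hv2 hw2 hv hw
    by_contra hne
    have hx2 : orderOf x ≠ 2 := by
      intro hx2
      rcases eq_one_or_eq_of_mem_zpowers hx2 hv with h0 | h0
      · exact ne_one_of_orderOf_eq_two hv2 h0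
      · exact hvx h0
    have hnc : ¬ Comparable x y := by
      rintro (hc | hc)
      · exact hyv (Or.inr (mem_zpowers_trans hv hc))
      · exact hne (involution_unique hv2 hw2 hv (mem_zpowers_trans hw hc))
    have h1 : x⁻¹ ≠ y := by
      rintro rfl
      exact hnc (comparable_inv_left.2 (comparable_refl x)).symm
    have := h x⁻¹ (inv_ne_self hx1 hx2) h1 fun hiff =>
      hnc (comparable_inv_left.1
        (hiff.1 (comparable_inv_left.2 (comparable_refl x)).symm).symm)
    exact hx2 (by simpa using this)
  have hmem : ∀ {a u : G}, a ≠ 1 → orderOf u = 2 → Comparable a u → u ∈ zpowers a :=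
    fun ha hu hc => mem_zpowers_of_comparable hu ha hc.symm
  have h' : ∀ z, z ≠ y → z ≠ x → ¬ (Comparable y z ↔ Comparable x z) → orderOf z = 2 :=
    fun z h1 h2 h3 => h z h2 h1 fun h4 => h3 h4.symm
  by_cases hcv : Comparable x v <;> by_cases hcw : Comparable x w
  · exact involution_unique hv2 hw2 (hmem hx1 hv2 hcv) (hmem hx1 hw2 hcw)
  · exact key hx1 hy1 h hvx (by tauto) hv2 hw2 (hmem hx1 hv2 hcv) (hmem hy1 hw2 (by tauto))
  · exact key hy1 hx1 h' hvy hcv hv2 hw2 (hmem hy1 hv2 (by tauto)) (hmem hx1 hw2 hcw)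
  · exact involution_unique hv2 hw2 (hmem hy1 hv2 (by tauto)) (hmem hy1 hw2 (by tauto))

end Structure

/-! ### The groups in `Ψ` -/

section Psi

variable [Finite G]

theorem IsPsi.exists_prime_order (h : IsPsi G) : ∃ y : G, (orderOf y).Prime ∧ Odd (orderOf y) ∧
    (∀ z, z ≠ 1 → orderOf z ≠ 2 → y ∈ zpowers z) ∧
    (∀ w, orderOf w = 2 → ∃ g, w ∈ zpowers g ∧ y ∈ zpowers g) ∧ ∃ w : G, orderOf w = 2 := by
  obtain ⟨-, p, hp, hodd, hpf, ⟨H, hH, hHu⟩, h4, hinv⟩ := h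
  have : Fact p.Prime := ⟨hp⟩
  have hcard : ∀ q, q.Prime → (q ∣ Nat.card G ↔ q = 2 ∨ q = p) := by
    intro q hq
    have := Finset.ext_iff.1 hpf q
    rw [Nat.mem_primeFactors_of_ne_zero Nat.card_pos.ne', Finset.mem_insert,
      Finset.mem_singleton] at this
    rw [← this]
    exact ⟨fun h => ⟨hq, h⟩, fun h => h.2⟩
  obtain ⟨y, hy⟩ := exists_prime_orderOf_dvd_card' p ((hcard p hp).2 (Or.inr rfl))
  obtain ⟨w, hw⟩ := exists_prime_orderOf_dvd_card' 2 ((hcard 2 Nat.prime_two).2 (Or.inl rfl))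
  have hyH : zpowers y = H := hHu _ ((Nat.card_zpowers y).trans hy)
  have hmem : ∀ z : G, p ∣ orderOf z → y ∈ zpowers z := by
    intro z hz
    have hc : zpowers (z ^ (orderOf z / p)) = H := by
      apply hHu
      rw [Nat.card_zpowers, orderOf_pow_orderOf_div (orderOf_pos z).ne' hz]
    have : y ∈ zpowers (z ^ (orderOf z / p)) := by
      rw [hc, ← hyH]
      exact mem_zpowers y
    exact mem_zpowers_trans this (pow_mem (mem_zpowers z) _)
  refine ⟨y, hy ▸ hp, hy ▸ hodd, fun z hz1 hz2 => hmem z ?_, fun u hu => ?_, w, hw⟩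
  · by_contra hpz
    -- With `p` excluded the order is a power of 2, and an exponent of at least 2 would give an
    -- element of order 4.
    have h2 : orderOf z = 2 ^ (orderOf z).primeFactorsList.length := by
      refine Nat.eq_prime_pow_of_unique_prime_dvd (orderOf_pos z).ne' fun {d} hd hdz => ?_
      rcases (hcard d hd).1 (hdz.trans (orderOf_dvd_natCard z)) with hd2 | hdp
      · exact hd2
      · exact absurd (hdp ▸ hdz) hpz
    generalize (orderOf z).primeFactorsList.length = k at h2
    match k, h2 with
    | 0, h2 => exact hz1 (orderOf_eq_one_iff.1 (by simpa using h2))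
    | 1, h2 => exact hz2 (by simpa using h2)
    | k + 2, h2 =>
      refine h4 ⟨z ^ (orderOf z / 4), orderOf_pow_orderOf_div (orderOf_pos z).ne' ?_⟩
      exact ⟨2 ^ k, by rw [h2, pow_add]; ring⟩
  · obtain ⟨C, hC, hCc, huC⟩ := hinv u hu
    obtain ⟨g, hg⟩ := hC.exists_generator
    have hgC : zpowers (g : G) = C := by
      apply Subgroup.eq_of_le_of_card_ge (zpowers_le.2 g.2)
      rw [Nat.card_zpowers, Subgroup.orderOf_coe, ← Nat.card_zpowers,
        (Subgroup.eq_top_iff' _).2 hg, Subgroup.card_top]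
    refine ⟨g, by rwa [hgC], hmem g ?_⟩
    rw [← Nat.card_zpowers, hgC, hCc]
    exact dvd_mul_left p 2

/-- A cyclic group containing both `w` and `y` must also contain any twin of `w`, and it has only
one involution. -/
theorem isSingletonInvolution_of_not_comparable {y : G}
    (hodd : Odd (orderOf y)) (hy1 : y ≠ 1)
    (hmem : ∀ z, z ≠ 1 → orderOf z ≠ 2 → y ∈ zpowers z)
    (hinv : ∀ w, orderOf w = 2 → ∃ g, w ∈ zpowers g ∧ y ∈ zpowers g) {w : G}
    (hw : ¬ Comparable y w) : IsSingletonInvolution w := by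
  have hord : ∀ z, ¬ Comparable y z → orderOf z = 2 := by
    intro z hz
    by_contra h2
    by_cases h1 : z = 1
    · subst h1
      exact hz (comparable_one_left y).symm
    · exact hz (Or.inl (hmem z h1 h2))
  refine ⟨hord w hw, fun z hz => ?_⟩
  by_contra hzw
  have hy2 : orderOf y ≠ 2 := by
    intro h2
    rw [h2] at hodd
    exact absurd hodd (by decide)
  have hyw : y ≠ w := by
    rintro rfl
    exact hw (comparable_refl y)
  have hzy : z ≠ y := by
    rintro rfl
    exact hw (hz.symm.comparable hy2)
  have hyz : ¬ Comparable y z := by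
    intro hc
    exact hw ((hz.comparable_iff hyw hzy.symm).2 hc.symm).symm
  obtain ⟨g, hwg, hyg⟩ := hinv w (hord w hw)
  have hgw : g ≠ w := by
    rintro rfl
    exact hw (Or.inl hyg)
  have hgz : g ≠ z := by
    rintro rfl
    exact hyz (Or.inl hyg)
  have hg1 : g ≠ 1 := by
    rintro rfl
    rw [zpowers_one_eq_bot, mem_bot] at hyg
    exact hy1 hyg
  have hzg := mem_zpowers_of_comparable (hord z hyz) hg1
    ((hz.comparable_iff hgw hgz).1 (Or.inl hwg))
  exact hzw (involution_unique (hord z hyz) (hord w hw) hzg hwg)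

/-- A split pair would make `x` a generator of the group. Here `y` generates the subgroup of order
`p`, so `x` is comparable with everything, and the absence of elements of order 4 excludes proper
cyclic overgroups of `zpowers x`. -/
theorem IsPsi.not_isSplitBy (h : IsPsi G) {x y w : G} : ¬ IsSplitBy x y w := by
  intro hs
  apply h.1
  have h4 : ¬ ∃ x : G, orderOf x = 4 := by
    obtain ⟨-, p, -, -, -, -, h4, -⟩ := h
    exact h4
  obtain ⟨v, hp, hodd, hmem, hinv, -⟩ := h.exists_prime_order
  have hw := hs.orderOf_eq
  have hvy : v ∈ zpowers y := hmem y hs.ne_one hs.orderOf_right_ne_two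
  have hvx : v ∈ zpowers x := mem_zpowers_trans hvy hs.mem
  have hcomm : Commute w v := by
    obtain ⟨a, rfl⟩ := mem_zpowers_iff.1 hs.mem_left
    obtain ⟨b, rfl⟩ := mem_zpowers_iff.1 hvx
    exact Commute.zpow_zpow_self x a b
  have hord : orderOf (w * v) = 2 * orderOf v := by
    rw [hcomm.orderOf_mul_eq_mul_orderOf_of_coprime, hw]
    rw [hw]
    exact Nat.coprime_two_left.2 hodd
  have hwvy : w * v ∉ zpowers y := fun hc =>
    hs.not_mem_right ((mul_mem_cancel_right hvy).1 hc)
  have hywv : y ∈ zpowers (w * v) := by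
    by_cases hx : w * v = x
    · rw [hx]
      exact hs.mem
    have h1 : w * v ≠ y := fun hc => hwvy (hc ▸ mem_zpowers y)
    have h2 : w * v ≠ w := by
      intro hc
      rw [mul_eq_left] at hc
      rw [hc, orderOf_one] at hp
      exact Nat.not_prime_one hp
    exact ((hs.comparable_iff _ hx h1 h2).1
      (Or.inr (mul_mem hs.mem_left hvx))).resolve_right hwvy
  have hyv : y ∈ zpowers v := by
    have hd := orderOf_dvd_of_mem_zpowers hywv
    rw [hord] at hd
    have hd' := (Nat.coprime_two_right.2 hs.odd_orderOf).dvd_of_dvd_mul_left hd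
    have : zpowers v = zpowers y :=
      Subgroup.eq_of_le_of_card_ge (zpowers_le.2 hvy) (by
        rw [Nat.card_zpowers, Nat.card_zpowers]
        exact Nat.le_of_dvd hp.pos hd')
    rw [this]
    exact mem_zpowers y
  have hall : ∀ z, Comparable x z := by
    intro z
    by_cases hz1 : z = 1
    · subst hz1
      exact (comparable_one_left x).symm
    by_cases hz2 : orderOf z = 2
    · obtain ⟨g, hzg, hvg⟩ := hinv z hz2
      rw [hs.involution_eq hz2 hzg (mem_zpowers_trans hyv hvg)]
      exact Or.inr hs.mem_left
    · exact hs.comparable_of_mem (mem_zpowers_trans hyv (hmem z hz1 hz2))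
  refine ⟨x, fun z => ?_⟩
  rcases hall z with hz | hz
  swap
  · exact hz
  have hwz := mem_zpowers_trans hs.mem_left hz
  obtain ⟨m, hm⟩ : 2 ∣ orderOf z := hw ▸ orderOf_dvd_of_mem_zpowers hwz
  have hmodd : Odd m := by
    rw [← Nat.not_even_iff_odd]
    rintro ⟨k, rfl⟩
    exact h4 ⟨_, orderOf_pow_orderOf_div (orderOf_pos z).ne' ⟨k, by rw [hm]; ring⟩⟩
  have hz2 : orderOf (z ^ 2) = m := by
    rw [orderOf_pow_of_dvd two_ne_zero ⟨m, hm⟩, hm, Nat.mul_div_cancel_left _ two_pos]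
  -- As `z` has order `2m` with `m` odd, `z ^ 2` has odd order and cannot have `w` among its powers.
  -- So `z ^ 2` is a power of `x`, as is `z ^ m = w`, and these two generate `z`.
  rcases hall (z ^ 2) with hc | hc
  · have := orderOf_dvd_of_mem_zpowers (mem_zpowers_trans hs.mem_left hc)
    rw [hw, hz2] at this
    exact absurd (even_iff_two_dvd.2 this) (Nat.not_even_iff_odd.2 hmodd)
  · have hzm : orderOf (z ^ m) = 2 := by
      have hm0 : m ≠ 0 := hmodd.pos.ne'
      rw [orderOf_pow_of_dvd hm0 ⟨2, by rw [hm, mul_comm]⟩, hm,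
        Nat.mul_div_cancel _ hmodd.pos]
    have hzmw : z ^ m = w := involution_unique hzm hw (pow_mem (mem_zpowers z) m) hwz
    obtain ⟨k, hk⟩ := hmodd
    have hk' : z = ((z ^ 2) ^ k)⁻¹ * z ^ m := by
      rw [hk, pow_add, pow_mul, pow_one, inv_mul_cancel_left]
    rw [hk', hzmw]
    exact mul_mem (inv_mem (pow_mem hc k)) hs.mem_left

end Psi

/-! ### Lower bound: classes contained in every resolving set -/

section LowerBound

variable [Finite G]

theorem twinClass_injOn_compl {S : Set G} (hS : IsResolvingSet (powerGraph G) S) :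
    Set.InjOn (twinClass (G := G)) Sᶜ := by
  intro x hx y hy hxy
  by_contra hne
  obtain ⟨s, hs, hs'⟩ := isResolvingSet_iff.1 hS x hx y hy hne
  refine hs' ((twinClass_eq_iff.1 hxy).comparable_iff ?_ ?_)
  · rintro rfl; exact hx hs
  · rintro rfl; exact hy hs

theorem ncard_compl_add_le {S : Set G} (hS : IsResolvingSet (powerGraph G) S)
    {M : Set (Set G)} (hM : M ⊆ twinClasses G)
    (hdisj : ∀ C ∈ M, ∀ t ∉ S, C ≠ twinClass t) :
    Sᶜ.ncard + M.ncard ≤ (twinClasses G).ncard := by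
  rw [← Set.InjOn.ncard_image (twinClass_injOn_compl hS), ← Set.ncard_union_eq]
  · refine Set.ncard_le_ncard (Set.union_subset ?_ hM)
    rintro _ ⟨t, -, rfl⟩
    exact ⟨t, rfl⟩
  · rw [Set.disjoint_left]
    rintro _ ⟨t, ht, rfl⟩ hC
    exact hdisj _ hC t ht rfl

/-- If only involutions without proper twins separate `x` from `y`, then a resolving set contains
the class of `x`, the class of `y`, or one of these involutions. -/
theorem exists_missing {S : Set G} (hS : IsResolvingSet (powerGraph G) S) {x y : G}
    (hxy : ¬ Twin x y)
    (h : ∀ z, z ≠ x → z ≠ y → ¬ (Comparable x z ↔ Comparable y z) → IsSingletonInvolution z) :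
    (∀ t ∉ S, ¬ Twin x t) ∨ (∀ t ∉ S, ¬ Twin y t) ∨
      ∃ w ∈ S, w ≠ x ∧ w ≠ y ∧ ¬ (Comparable x w ↔ Comparable y w) := by
  by_contra! hc
  obtain ⟨⟨t, ht, hxt⟩, ⟨u, hu, hyu⟩, hS'⟩ := hc
  have hne : x ≠ y := by
    rintro rfl
    exact hxy (.refl x)
  have htu : t ≠ u := by
    rintro rfl
    exact hxy (hxt.trans hyu.symm)
  obtain ⟨s, hs, hsep⟩ := isResolvingSet_iff.1 hS t ht u hu htu
  have hst : s ≠ t := by rintro rfl; exact ht hs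
  have hsu : s ≠ u := by rintro rfl; exact hu hs
  -- Replacing `t, u` by their twins `x, y` is delicate only when the separator is `x` or `y`
  -- itself. If `x` separated `t` from `u`, then `t` would separate `x` from `y` and so have no twin
  -- but itself, against `Twin x t`.
  have hkey : ∀ {x y t u : G}, ¬ Twin x y → x ≠ y → Twin x t → Twin y u → x ≠ t → x ≠ u →
      (∀ z, z ≠ x → z ≠ y → ¬ (Comparable x z ↔ Comparable y z) → IsSingletonInvolution z) →
      (Comparable t x ↔ Comparable u x) := by
    intro x y t u hxy hne hxt hyu hxt' hxu h
    by_contra hsep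
    have hty : t ≠ y := by
      rintro rfl
      exact hxy hxt
    refine hxt' ((h t hxt'.symm hty fun hiff => hsep ?_).2 x hxt.symm)
    rw [comparable_comm, hiff, comparable_comm, ← hxt.comparable_iff hne.symm hty.symm,
      comparable_comm, hyu.comparable_iff hne hxu]
  by_cases hsx : s = x
  · subst hsx
    exact hsep (hkey hxy hne hxt hyu hst hsu h)
  by_cases hsy : s = y
  · subst hsy
    exact hsep (hkey (fun ht => hxy ht.symm) hne.symm hyu hxt hsu hst
      fun z h1 h2 h3 => h z h2 h1 fun h4 => h3 h4.symm).symm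
  apply hsep
  rw [← hxt.comparable_iff hsx hst, ← hyu.comparable_iff hsy hsu]
  exact hS' s hs hsx hsy

theorem resolvingInvolution_cases {w : G} (hw : w ∈ resolvingInvolutions G) :
    IsSingletonInvolution w ∧ ∃ x y : G, ¬ Twin x y ∧
      (∀ z, z ≠ x → z ≠ y → ¬ (Comparable x z ↔ Comparable y z) → z = w) ∧
      ((resolvingInvolutions G).Subsingleton ∨ IsSplitBy x y w) := by
  obtain ⟨hw2, x, y, hx, hy, hR⟩ := hw
  have hxw : x ≠ w := by
    rintro rfl
    exact hx (.refl _)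
  have hyw : y ≠ w := by
    rintro rfl
    exact hy (.refl _)
  have hwR : w ∈ resolvers x y := by rw [hR]; simp
  have hwsep := (mem_resolvers_iff hxw.symm hyw.symm).1 hwR
  have hxy : ¬ Twin x y := fun h => hwsep (h.comparable_iff hxw.symm hyw.symm)
  have huniq : ∀ z, z ≠ x → z ≠ y → ¬ (Comparable x z ↔ Comparable y z) → z = w := by
    intro z hzx hzy hz
    have := (mem_resolvers_iff hzx hzy).2 hz
    rw [hR] at this
    exact (this.resolve_left hzx).resolve_left hzy
  -- A twin of `w` lies outside `{x, y}` and separates them as `w` does, so it is `w`.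
  have hsing : IsSingletonInvolution w := by
    refine ⟨hw2, fun z hz => ?_⟩
    have hzx : z ≠ x := by
      rintro rfl
      exact hx hz
    have hzy : z ≠ y := by
      rintro rfl
      exact hy hz
    refine huniq z hzx hzy fun hiff => hwsep ?_
    rw [comparable_comm, hz.comparable_iff hxw hzx.symm, comparable_comm, hiff, comparable_comm,
      ← hz.comparable_iff hyw hzy.symm, comparable_comm]
  refine ⟨hsing, ?_⟩
  -- When the pair contains `1`, the other member `v` has odd order, so every involution is
  -- incomparable with `v` and equals `w`.
  have hone : ∀ v, ¬ Twin 1 v →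
      (∀ z, z ≠ 1 → z ≠ v → ¬ (Comparable 1 z ↔ Comparable v z) → z = w) →
      (resolvingInvolutions G).Subsingleton := by
    intro v hv hu
    have h1 : ∀ z, ¬ Comparable v z → z = w := by
      intro z hz
      refine hu z ?_ ?_ fun hiff => hz (hiff.1 (comparable_one_left z))
      · rintro rfl
        exact hz (comparable_one_left v).symm
      · rintro rfl
        exact hz (comparable_refl z)
    have hvw : ¬ Comparable v w := by
      intro hc
      refine hv (twin_iff.2 fun z _ _ => iff_of_true (comparable_one_left z) ?_)
      by_contra hz
      exact hz (h1 z hz ▸ hc)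
    obtain ⟨hp, hodd⟩ := prime_orderOf_of_singleton (fun z hz => h1 z hz ▸ hsing) hvw
    have hv1 : v ≠ 1 := by
      rintro rfl
      exact hv (.refl 1)
    intro a ha b hb
    rw [h1 a (not_comparable_of_odd ha.1 hv1 hodd), h1 b (not_comparable_of_odd hb.1 hv1 hodd)]
  have hyx : ¬ Twin y x := fun h => hxy h.symm
  have huniq' : ∀ z, z ≠ y → z ≠ x → ¬ (Comparable y z ↔ Comparable x z) → z = w :=
    fun z h1 h2 h3 => huniq z h2 h1 fun h4 => h3 h4.symm
  by_cases hx1 : x = 1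
  · subst hx1
    exact ⟨1, y, hxy, huniq, Or.inl (hone y hxy huniq)⟩
  by_cases hy1 : y = 1
  · subst hy1
    exact ⟨1, x, hyx, huniq', Or.inl (hone x hyx huniq')⟩
  rcases isSplitBy_or_isSplitBy hw2 hx1 hy1 hxw hyw hR with h | h
  · exact ⟨x, y, hxy, huniq, Or.inr h⟩
  · exact ⟨y, x, hyx, huniq', Or.inr h⟩

theorem IsSplitBy.eq_of_comparable {x y w x' y' w' : G} (h : IsSplitBy x y w)
    (h' : IsSplitBy x' y' w') (hc : Comparable y' x) : w = w' := by
  rcases hc with hc | hc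
  · exact h'.involution_eq h.orderOf_eq h.mem_left hc
  · exact absurd (Or.inr (mem_zpowers_trans h.mem_left hc))
      (not_comparable_of_odd h.orderOf_eq h'.ne_one h'.odd_orderOf)

/-- Triples belonging to distinct involutions have no classes in common. -/
theorem IsSplitBy.eq_of_twin {x y w x' y' w' a a' : G} (h : IsSplitBy x y w)
    (h' : IsSplitBy x' y' w') (hw : IsSingletonInvolution w) (hw' : IsSingletonInvolution w')
    (ha : a = x ∨ a = y ∨ a = w) (ha' : a' = x' ∨ a' = y' ∨ a' = w') (ht : Twin a a') :
    w = w' := by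
  rcases ha with rfl | rfl | rfl
  · rcases ha' with rfl | rfl | rfl
    · rcases ht.comparable h.orderOf_left_ne_two with hc | hc
      · exact involution_unique h.orderOf_eq h'.orderOf_eq (mem_zpowers_trans h.mem_left hc)
          h'.mem_left
      · exact involution_unique h.orderOf_eq h'.orderOf_eq h.mem_left
          (mem_zpowers_trans h'.mem_left hc)
    · exact h.eq_of_comparable h' (ht.comparable h.orderOf_left_ne_two).symm
    · exact absurd (hw'.2 _ ht.symm ▸ hw'.1) h.orderOf_left_ne_two
  · rcases ha' with rfl | rfl | rfl
    · exact (h'.eq_of_comparable h (ht.comparable h.orderOf_right_ne_two)).symm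
    · apply h.eq_of_comparable h'
      by_cases hxy : x = a'
      · rw [hxy]
        exact comparable_refl a'
      · refine (ht.comparable_iff ?_ hxy).1 (Or.inl h.mem)
        rintro rfl
        exact h.not_mem_right h.mem_left
    · exact absurd (hw'.2 _ ht.symm ▸ hw'.1) h.orderOf_right_ne_two
  · rcases ha' with rfl | rfl | rfl
    · exact absurd (hw.2 _ ht ▸ hw.1) h'.orderOf_left_ne_two
    · exact absurd (hw.2 _ ht ▸ hw.1) h'.orderOf_right_ne_two
    · exact (hw.2 _ ht).symm

theorem ncard_compl_add_ncard_resolvingInvolutions_le {S : Set G}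
    (hS : IsResolvingSet (powerGraph G) S) :
    Sᶜ.ncard + (resolvingInvolutions G).ncard ≤ (twinClasses G).ncard := by
  -- Each resolving involution is charged to one class of its triple lying in `S`; the second clause
  -- makes the charging injective.
  have key : ∀ w ∈ resolvingInvolutions G, ∃ a : G, (∀ t ∉ S, ¬ Twin a t) ∧
      ((resolvingInvolutions G).Subsingleton ∨
        ∃ x y, IsSplitBy x y w ∧ (a = x ∨ a = y ∨ a = w)) := by
    intro w hw
    obtain ⟨hsing, x, y, hxy, huniq, hsplit⟩ := resolvingInvolution_cases hw
    rcases exists_missing hS hxy fun z h1 h2 h3 => huniq z h1 h2 h3 ▸ hsing with h | h | h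
    · exact ⟨x, h, hsplit.imp id fun hs => ⟨x, y, hs, Or.inl rfl⟩⟩
    · exact ⟨y, h, hsplit.imp id fun hs => ⟨x, y, hs, Or.inr (Or.inl rfl)⟩⟩
    · obtain ⟨v, hv, h1, h2, h3⟩ := h
      obtain rfl := huniq v h1 h2 h3
      refine ⟨v, fun t ht htw => ht (hsing.2 t htw ▸ hv),
        hsplit.imp id fun hs => ⟨x, y, hs, Or.inr (Or.inr rfl)⟩⟩
  choose! f hf hf' using key
  have hinj : Set.InjOn (fun w => twinClass (f w)) (resolvingInvolutions G) := by
    intro v hv w hw hvw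
    rcases hf' v hv with h | ⟨x, y, hs, hx⟩
    · exact h hv hw
    rcases hf' w hw with h | ⟨x', y', hs', hx'⟩
    · exact h hv hw
    exact hs.eq_of_twin hs' (resolvingInvolution_cases hv).1 (resolvingInvolution_cases hw).1
      hx hx' (twinClass_eq_iff.1 hvw)
  rw [← Set.InjOn.ncard_image hinj]
  apply ncard_compl_add_le hS
  · rintro _ ⟨w, -, rfl⟩
    exact ⟨f w, rfl⟩
  · rintro _ ⟨w, hw, rfl⟩ t ht hC
    exact hf w hw t ht (twinClass_eq_iff.1 hC)

/-- For `y` of order `p`, the pair `1, y` is separated only by singleton involutions, and at least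
one exists. -/
theorem IsPsi.ncard_compl_add_one_le (h : IsPsi G) {S : Set G}
    (hS : IsResolvingSet (powerGraph G) S) : Sᶜ.ncard + 1 ≤ (twinClasses G).ncard := by
  obtain ⟨y, hp, hodd, hmem, hinv, w, hw⟩ := h.exists_prime_order
  have hy1 : y ≠ 1 := by
    rintro rfl
    rw [orderOf_one] at hp
    exact Nat.not_prime_one hp
  have hsing : ∀ z, ¬ (Comparable 1 z ↔ Comparable y z) → IsSingletonInvolution z := by
    intro z hz
    exact isSingletonInvolution_of_not_comparable hodd hy1 hmem hinv
      fun hc => hz (iff_of_true (comparable_one_left z) hc)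
  have hyw := not_comparable_of_odd hw hy1 hodd
  have hne : ¬ Twin 1 y := by
    intro ht
    refine hyw ((ht.comparable_iff (ne_one_of_orderOf_eq_two hw) ?_).1 (comparable_one_left w))
    rintro rfl
    exact hyw (comparable_refl _)
  obtain ⟨a, ha⟩ : ∃ a : G, ∀ t ∉ S, ¬ Twin a t := by
    rcases exists_missing hS hne fun z _ _ hz => hsing z hz with h | h | ⟨v, hv, -, -, h⟩
    · exact ⟨1, h⟩
    · exact ⟨y, h⟩
    · exact ⟨v, fun t ht htv => ht ((hsing v h).2 t htv ▸ hv)⟩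
  rw [← Set.ncard_singleton (twinClass a)]
  refine ncard_compl_add_le hS ?_ ?_
  · rintro _ rfl
    exact ⟨a, rfl⟩
  · rintro _ rfl t ht hC
    exact ha t ht (twinClass_eq_iff.1 hC)

end LowerBound

/-! ### Upper bound: resolving sets from a transversal -/

section UpperBound

variable [Finite G]

theorem exists_transversal (G : Type*) [Group G] [Finite G] : ∃ T : Set G,
    (∀ a ∈ T, ∀ b ∈ T, Twin a b → a = b) ∧ (∀ x, ∃ t ∈ T, Twin x t) ∧
      T.ncard = (twinClasses G).ncard := by
  have hne : ∀ C ∈ twinClasses G, ∃ t : G, C = twinClass t := fun _ h => h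
  choose! r hr using hne
  refine ⟨r '' twinClasses G, ?_, fun x => ?_, ?_⟩
  · rintro _ ⟨C, hC, rfl⟩ _ ⟨D, hD, rfl⟩ h
    rw [hr C hC, hr D hD, twinClass_eq_iff.2 h]
  · exact ⟨r (twinClass x), ⟨_, ⟨x, rfl⟩, rfl⟩, twinClass_eq_iff.1 (hr _ ⟨x, rfl⟩)⟩
  · apply Set.InjOn.ncard_image
    intro C hC D hD h
    rw [hr C hC, hr D hD, h]

/-- A twin of a separator separates too, hence lies in `T`, which meets each class at most once. In
particular `z⁻¹ = z`. -/
theorem isSingletonInvolution_of_separates {T : Set G}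
    (hT : ∀ a ∈ T, ∀ b ∈ T, Twin a b → a = b) {x y : G} (hx : x ∈ T) (hy : y ∈ T)
    (h : ∀ s, ¬ (Comparable x s ↔ Comparable y s) → s ∈ T) {z : G} (hzx : z ≠ x) (hzy : z ≠ y)
    (hz : ¬ (Comparable x z ↔ Comparable y z)) : IsSingletonInvolution z := by
  have hzT := h z hz
  have huniq : ∀ u, Twin z u → u = z := by
    intro u hu
    by_contra hne
    have huT : u ∉ T := fun huT => hne (hT z hzT u huT hu).symm
    refine huT (h u fun hiff => hz ?_)
    have hux : x ≠ u := by rintro rfl; exact huT hx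
    have huy : y ≠ u := by rintro rfl; exact huT hy
    rw [comparable_comm, hu.comparable_iff hzx.symm hux, comparable_comm, hiff, comparable_comm,
      ← hu.comparable_iff hzy.symm huy, comparable_comm]
  refine ⟨?_, huniq⟩
  by_contra h2
  refine inv_ne_self ?_ h2 (huniq _ (twin_inv z))
  rintro rfl
  exact hz (iff_of_true (comparable_one_left x).symm (comparable_one_left y).symm)

/-- If only involutions without proper twins separate `x` from `y`, then there is exactly one of
them, or the group belongs to `Ψ` and one of `x`, `y` is trivial. -/
theorem exists_unique_separator {x y : G} (hxy : ¬ Twin x y)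
    (h : ∀ z, z ≠ x → z ≠ y → ¬ (Comparable x z ↔ Comparable y z) → IsSingletonInvolution z) :
    (∃ w, orderOf w = 2 ∧ x ∉ twinClass w ∧ y ∉ twinClass w ∧ resolvers x y = {x, y, w}) ∨
      (IsPsi G ∧ (x = 1 ∨ y = 1)) := by
  have hne : x ≠ y := by
    rintro rfl
    exact hxy (.refl x)
  rw [twin_iff] at hxy
  simp only [not_forall] at hxy
  obtain ⟨w, hwx, hwy, hw⟩ := hxy
  by_cases huniq : ∀ z, z ≠ x → z ≠ y → ¬ (Comparable x z ↔ Comparable y z) → z = w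
  · have hsing := h w hwx hwy hw
    refine Or.inl ⟨w, hsing.1, fun ht => hwx (hsing.2 x ht).symm,
      fun ht => hwy (hsing.2 y ht).symm, ?_⟩
    ext z
    constructor
    · intro hz
      by_cases hzx : z = x
      · exact Or.inl hzx
      by_cases hzy : z = y
      · exact Or.inr (Or.inl hzy)
      exact Or.inr (Or.inr (huniq z hzx hzy ((mem_resolvers_iff hzx hzy).1 hz)))
    · rintro (rfl | rfl | rfl)
      · exact left_mem_resolvers hne
      · rw [resolvers_comm]
        exact left_mem_resolvers hne.symm
      · exact (mem_resolvers_iff hwx hwy).2 hw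
  right
  simp only [not_forall] at huniq
  obtain ⟨v, hvx, hvy, hv, hvw⟩ := huniq
  have hone : ∀ {y : G}, (∀ z, z ≠ 1 → z ≠ y → ¬ (Comparable 1 z ↔ Comparable y z) →
      IsSingletonInvolution z) → ¬ (Comparable 1 v ↔ Comparable y v) →
      ¬ (Comparable 1 w ↔ Comparable y w) → IsPsi G := by
    intro y h hv hw
    refine isPsi_of_singleton (y := y) (fun z hz => h z ?_ ?_ fun hiff => hz (hiff.1 ?_))
      (fun hc => hv (iff_of_true (comparable_one_left v) hc))
      (fun hc => hw (iff_of_true (comparable_one_left w) hc)) hvw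
    · rintro rfl
      exact hz (comparable_one_left y).symm
    · rintro rfl
      exact hz (comparable_refl z)
    · exact comparable_one_left z
  by_cases hx1 : x = 1
  · subst hx1
    exact ⟨hone h hv hw, Or.inl rfl⟩
  by_cases hy1 : y = 1
  · subst hy1
    exact ⟨hone (fun z h1 h2 h3 => h z h2 h1 fun h4 => h3 h4.symm) (fun h4 => hv h4.symm)
      (fun h4 => hw h4.symm), Or.inr rfl⟩
  exact absurd (separating_involution_unique hx1 hy1
    (fun z h1 h2 h3 => (h z h1 h2 h3).1) hvx hvy hv hwx hwy hw) hvw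

theorem isResolvingSet_compl_diff {T : Set G} (hT : ∀ a ∈ T, ∀ b ∈ T, Twin a b → a = b)
    (hG : ¬ IsPsi G) : IsResolvingSet (powerGraph G) (T \ resolvingInvolutions G)ᶜ := by
  refine isResolvingSet_iff.2 fun x hx y hy hne => ?_
  rw [Set.notMem_compl_iff] at hx hy
  by_contra! hc
  have hsub : ∀ s, ¬ (Comparable x s ↔ Comparable y s) → s ∈ T \ resolvingInvolutions G := by
    intro s hs
    by_contra hsT
    exact hs (hc s hsT)
  have hT' : ∀ a ∈ T \ resolvingInvolutions G, ∀ b ∈ T \ resolvingInvolutions G,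
      Twin a b → a = b := fun a ha b hb => hT a ha.1 b hb.1
  have hxy : ¬ Twin x y := fun ht => hne (hT' x hx y hy ht)
  rcases exists_unique_separator hxy
    (fun z => isSingletonInvolution_of_separates hT' hx hy hsub (z := z)) with
    ⟨w, hw, hxw, hyw, hR⟩ | h
  · have hwx : w ≠ x := by
      rintro rfl
      exact hxw (.refl _)
    have hwy : w ≠ y := by
      rintro rfl
      exact hyw (.refl _)
    have hwR : w ∈ resolvers x y := by rw [hR]; simp
    exact (hsub w ((mem_resolvers_iff hwx hwy).1 hwR)).2 ⟨hw, x, y, hxw, hyw, hR⟩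
  · exact hG h.1

/-- Dropping `e` from `T` removes `1` from the unresolved pairs, leaving only split pairs, which `Ψ`
forbids. -/
theorem IsPsi.isResolvingSet_compl_diff (hG : IsPsi G) {T : Set G}
    (hT : ∀ a ∈ T, ∀ b ∈ T, Twin a b → a = b) {e : G} (he : e ∈ T) (he1 : Twin 1 e) :
    IsResolvingSet (powerGraph G) (T \ {e})ᶜ := by
  refine isResolvingSet_iff.2 fun x hx y hy hne => ?_
  rw [Set.notMem_compl_iff] at hx hy
  by_contra! hc
  have hsub : ∀ s, ¬ (Comparable x s ↔ Comparable y s) → s ∈ T \ {e} := by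
    intro s hs
    by_contra hsT
    exact hs (hc s hsT)
  have hT' : ∀ a ∈ T \ {e}, ∀ b ∈ T \ {e}, Twin a b → a = b :=
    fun a ha b hb => hT a ha.1 b hb.1
  have hne1 : ∀ a ∈ T \ {e}, a ≠ 1 := by
    rintro _ ha rfl
    exact ha.2 (hT 1 ha.1 e he he1)
  have hxy : ¬ Twin x y := fun ht => hne (hT' x hx y hy ht)
  rcases exists_unique_separator hxy
    (fun z => isSingletonInvolution_of_separates hT' hx hy hsub (z := z)) with
    ⟨w, hw, hxw, hyw, hR⟩ | ⟨-, h | h⟩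
  · have hwx : x ≠ w := by
      rintro rfl
      exact hxw (.refl _)
    have hwy : y ≠ w := by
      rintro rfl
      exact hyw (.refl _)
    rcases isSplitBy_or_isSplitBy hw (hne1 x hx) (hne1 y hy) hwx hwy hR with h | h
    · exact hG.not_isSplitBy h
    · exact hG.not_isSplitBy h
  · exact hne1 x hx h
  · exact hne1 y hy h

end UpperBound

/-! ### Computing the dimension -/

/-- The metric dimension is the size of a resolving set whose complement is largest. -/
theorem metricDim_add_eq {V : Type*} [Finite V] {Γ : SimpleGraph V} {n : ℕ} {T : Set V}
    (hT : IsResolvingSet Γ Tᶜ) (hn : T.ncard = n)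
    (hmax : ∀ S, IsResolvingSet Γ S → Sᶜ.ncard ≤ n) : metricDim Γ + n = Nat.card V := by
  have h1 : metricDim Γ ≤ Tᶜ.ncard := Nat.sInf_le ⟨_, hT, rfl⟩
  have h2 : Tᶜ.ncard ≤ metricDim Γ := by
    refine le_csInf ⟨_, _, hT, rfl⟩ ?_
    rintro _ ⟨S, hS, rfl⟩
    have h3 := hmax S hS
    have h4 := Set.ncard_add_ncard_compl S
    have h5 := Set.ncard_add_ncard_compl T
    omega
  have h5 := Set.ncard_add_ncard_compl T
  omega

theorem metricDim_of_isPsi [Finite G] (h : IsPsi G) :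
    metricDim (powerGraph G) + (twinClasses G).ncard = Nat.card G + 1 := by
  obtain ⟨T, hT, hmeet, hcard⟩ := exists_transversal G
  obtain ⟨e, he, he1⟩ := hmeet 1
  have h1 := metricDim_add_eq (h.isResolvingSet_compl_diff hT he he1) rfl fun S hS => by
    have h2 := h.ncard_compl_add_one_le hS
    have h3 := Set.ncard_sdiff_singleton_add_one he
    omega
  have h3 := Set.ncard_sdiff_singleton_add_one he
  omega

theorem metricDim_of_not_isPsi [Finite G] (h : ¬ IsPsi G) :
    metricDim (powerGraph G) + (twinClasses G).ncard =
      Nat.card G + (resolvingInvolutions G).ncard := by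
  obtain ⟨T, hT, hmeet, hcard⟩ := exists_transversal G
  -- Resolving involutions are alone in their classes, so every transversal contains them.
  have hsub : resolvingInvolutions G ⊆ T := by
    intro w hw
    obtain ⟨t, ht, hwt⟩ := hmeet w
    exact (resolvingInvolution_cases hw).1.2 t hwt ▸ ht
  have h3 := Set.ncard_sdiff_add_ncard_of_subset hsub
  have h1 := metricDim_add_eq (isResolvingSet_compl_diff hT h) rfl fun S hS => by
    have h2 := ncard_compl_add_ncard_resolvingInvolutions_le hS
    omega
  omega

end PowerGraph

theorem mainTheorem1 (G : Type*) [Group G] [Finite G] :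
    (PowerGraph.IsPsi G →
      (PowerGraph.metricDim (PowerGraph.powerGraph G) : ℤ) =
        (Nat.card G : ℤ) - ((PowerGraph.twinClasses G).ncard : ℤ) + 1) ∧
    (¬ PowerGraph.IsPsi G →
      (PowerGraph.metricDim (PowerGraph.powerGraph G) : ℤ) =
        (Nat.card G : ℤ) - ((PowerGraph.twinClasses G).ncard : ℤ)
          + ((PowerGraph.resolvingInvolutions G).ncard : ℤ)) := by
  constructor
  · intro h
    have := PowerGraph.metricDim_of_isPsi h
    omega
  · intro h
    have := PowerGraph.metricDim_of_not_isPsi h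
    omega
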